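/- A machine is a partial computable function $M\colon 2^{<\omega}\to 2^{<\omega}$ on finite binary strings; it is prefix-free if no string in its domain is a proper prefix of another string in its domain. A prefix-free machine $U$ is universal if it simulates every prefix-free machine with constant overhead: for every prefix-free machine $M$ there is a constant $c$ such that whenever $M(\tau)=\sigma$ there is $\tau'$ with $U(\tau')=\sigma$ and $|\tau'|\le|\tau|+c$. Let $K_U(\sigma)=\min\{|\tau| : U(\tau)=\sigma\}$ and let $R_{K_U}=\{\sigma : K_U(\sigma)\ge|\sigma|\}$ be the set of random strings with respect to $U$. We write $A\le_{\mathrm{tt}}B$ if $A$ is truth-table reducible to $B$: there is a computable function assigning to each input $a$ a finite list of queries $b_1,\dots,b_k$ and a truth table on $k$ inputs, such that $a\in A$ if and only if the table gives the value $1$ on the row $(B(b_1),\dots,B(b_k))$. Theorem. For any two universal prefix-free machines $U_1$ and $U_2$ there is a noncomputable computably enumerable set $A\subseteq\mathbb{N}$ such that $A\le_{\mathrm{tt}}R_{K_{U_1}}$ and $A\le_{\mathrm{tt}}R_{K_{U_2}}$. Consequently $R_{K_{U_1}}$ and $R_{K_{U_2}}$ do not form a tt-minimal pair, that is, it is not the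 case that both are noncomputable and every set $A\subseteq\mathbb{N}$ that is tt-reducible to both of them is computable. -/

import Mathlib

namespace RandomStrings

/-- A prefix-free machine: a partial computable function on finite binary strings
such that no string in its domain is a proper prefix of another one. -/
structure IsPrefixFreeMachine (M : List Bool →. List Bool) : Prop where
  partrec : Partrec M
  prefixFree : ∀ σ τ : List Bool, (M σ).Dom → (M τ).Dom → σ <+: τ → σ = τ

/-- A universal prefix-free machine: a prefix-free machine that simulates every prefix-free
machine `M`, in that every `M`-description is matched by a `U`-description of the same string
which is longer by at most a constant depending only on `M`.  (Equivalently, `K_U` is minimal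
up to an additive constant.  Machines `U` which satisfy `U (ρ_M ++ τ) = M τ` for fixed coding
strings `ρ_M` are a special case, see `IsUniversal.of_coding`.) -/
structure IsUniversal (U : List Bool →. List Bool) : Prop where
  machine : IsPrefixFreeMachine U
  simulates : ∀ M : List Bool →. List Bool, IsPrefixFreeMachine M →
    ∃ c : ℕ, ∀ τ σ : List Bool, σ ∈ M τ → ∃ τ' : List Bool, σ ∈ U τ' ∧ τ'.length ≤ τ.length + c

theorem IsUniversal.of_coding {U : List Bool →. List Bool} (hU : IsPrefixFreeMachine U)
    (h : ∀ M : List Bool →. List Bool, IsPrefixFreeMachine M →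
      ∃ ρ : List Bool, ∀ τ : List Bool, U (ρ ++ τ) = M τ) : IsUniversal U := by
  refine ⟨hU, fun M hM => ?_⟩
  obtain ⟨ρ, hρ⟩ := h M hM
  refine ⟨ρ.length, fun τ σ hσ => ⟨ρ ++ τ, by rw [hρ]; exact hσ, ?_⟩⟩
  rw [List.length_append, add_comm]

/-- The complexity `K_M(σ)`: the least length of an `M`-description of `σ`
(`⊤` if there is none, which does not happen when `M` is universal). -/
noncomputable def K (M : List Bool →. List Bool) (σ : List Bool) : ℕ∞ :=
  ⨅ (τ : List Bool) (_ : σ ∈ M τ), (τ.length : ℕ∞)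

/-- The set `R_{K_U}` of strings that are random with respect to `U`. -/
def randomStrings (U : List Bool →. List Bool) : Set (List Bool) :=
  {σ | (σ.length : ℕ∞) ≤ K U σ}

open Classical in
/-- Truth-table reducibility `A ≤_tt B`: there are computable functions which assign to every
input `a` a finite list `queries a` of oracle queries and a truth table, given by the finite list
`rows a` of those rows (sequences of answers) on which the output is `1`, such that `a ∈ A` iff
the row of true answers about membership in `B` is one of them. -/
def TTReducible {α β : Type*} [Primcodable α] [Primcodable β] (A : Set α) (B : Set β) : Prop :=
  ∃ (queries : α → List β) (rows : α → List (List Bool)),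
    Computable queries ∧ Computable rows ∧
      ∀ a : α, a ∈ A ↔ (queries a).map (fun b => decide (b ∈ B)) ∈ rows a

/-- `B₁` and `B₂` form a tt-minimal pair: both are noncomputable, and every set that is
tt-reducible to both is computable. -/
def TTMinimalPair {β : Type*} [Primcodable β] (B₁ B₂ : Set β) : Prop :=
  ¬ ComputablePred (fun b => b ∈ B₁) ∧ ¬ ComputablePred (fun b => b ∈ B₂) ∧
    ∀ A : Set ℕ, TTReducible A B₁ → TTReducible A B₂ → ComputablePred (fun n => n ∈ A)

end RandomStrings

/-!
Call a length `x` dense if at least a `2⁻¹ ^ Nat.log 2 x` fraction of the strings of length `x` is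
nonrandom. The lengths that become dense at some stage of the enumeration satisfy a Kraft
inequality with weights `2⁻¹ ^ Nat.log 2 x`, so at the moment when `x` becomes dense every universal
machine can afford to compress `gap a x` further strings of length `x`. Each machine thus announces
the event by a jump in its own number of nonrandom strings, which a truth table can read off from
the random strings of length `x`. The converse has to be secured: on a length that is never dense,
no jump may occur. As the number of nonrandom strings of such a length is below a fixed multiple of
the gap, there is a largest `q` such that infinitely many lengths that are never dense reach `q`
gaps. Once a length has reached `q` gaps, a further jump of even one machine would exceed the level
`q`, and hence is possible only if the length becomes dense. The set of pairs `(x, t)` such that `x`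
has reached `q` gaps by stage `t` and becomes dense later is therefore reducible to the random
strings of each machine. It is not computable: otherwise one could compute a sequence of arbitrarily
large lengths that are never dense, but a universal machine can compress enough strings of the
lengths in any sufficiently fast growing computable sequence to make one of them dense.
-/

namespace RandomStrings

open Encodable Filter
open scoped ENNReal

/-! ### The Kraft inequality -/

theorem uniquelyDecodable_of_isAntichain {α : Type*} {S : Set (List α)} (h_nil : [] ∉ S)
    (hS : IsAntichain (· <+: ·) S) : InformationTheory.UniquelyDecodable S := by
  intro L₁
  induction L₁ with
  | nil =>
    rintro (_ | ⟨τ, L₂⟩) - h₂ h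
    · rfl
    · obtain rfl : τ = [] := (List.append_eq_nil_iff.1 h.symm).1
      exact absurd (h₂ _ List.mem_cons_self) h_nil
  | cons σ L₁ ih =>
    rintro (_ | ⟨τ, L₂⟩) h₁ h₂ h
    · obtain rfl : σ = [] := (List.append_eq_nil_iff.1 h).1
      exact absurd (h₁ _ List.mem_cons_self) h_nil
    · rw [List.flatten_cons, List.flatten_cons] at h
      rw [List.forall_mem_cons] at h₁ h₂
      obtain rfl : σ = τ := by
        rcases List.prefix_or_prefix_of_prefix (List.prefix_append σ L₁.flatten)
          (h ▸ List.prefix_append τ L₂.flatten) with hp | hp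
        · exact hS.eq h₁.1 h₂.1 hp
        · exact (hS.eq h₂.1 h₁.1 hp).symm
      rw [ih L₂ h₁.2 h₂.2 (List.append_cancel_left h)]

theorem sum_inv_card_pow_length_le_one_of_isAntichain {α : Type*} [Fintype α] [Nonempty α]
    {S : Finset (List α)} (hS : IsAntichain (· <+: ·) (S : Set (List α))) :
    ∑ σ ∈ S, (1 / Fintype.card α : ℝ) ^ σ.length ≤ 1 := by
  by_cases h_nil : [] ∈ S
  · have hS_eq : S = {[]} := Finset.eq_singleton_iff_unique_mem.2
      ⟨h_nil, fun σ hσ => (hS.eq h_nil hσ List.nil_prefix).symm⟩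
    simp [hS_eq]
  · exact InformationTheory.kraft_mcmillan_inequality (uniquelyDecodable_of_isAntichain h_nil hS)

theorem tsum_inv_two_pow_length_le_one_of_isAntichain {S : Set (List Bool)}
    (hS : IsAntichain (· <+: ·) S) : ∑' σ : S, (2⁻¹ : ℝ≥0∞) ^ σ.1.length ≤ 1 := by
  rw [ENNReal.tsum_eq_iSup_sum]
  refine iSup_le fun F => ?_
  have h : ∑ σ ∈ F.map (.subtype _), (1 / Fintype.card Bool : ℝ) ^ σ.length ≤ 1 :=
    sum_inv_card_pow_length_le_one_of_isAntichain <| hS.subset <| by simp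
  rw [Finset.sum_map, Fintype.card_bool] at h
  rw [← ENNReal.toReal_le_toReal (ENNReal.sum_ne_top.2 fun σ _ => by simp) ENNReal.one_ne_top,
    ENNReal.toReal_sum fun σ _ => by simp]
  simpa using h

theorem tsum_inv_two_pow_succ : ∑' n : ℕ, (2⁻¹ : ℝ≥0∞) ^ (n + 1) = 1 := by
  rw [ENNReal.tsum_geometric_add_one, ENNReal.one_sub_inv_two, inv_inv,
    ENNReal.inv_mul_cancel two_ne_zero ENNReal.ofNat_ne_top]

theorem natCast_mul_inv_two_pow_le_iff {m n k l : ℕ} :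
    (m : ℝ≥0∞) * 2⁻¹ ^ k ≤ n * 2⁻¹ ^ l ↔ m * 2 ^ l ≤ n * 2 ^ k := by
  rw [← ENNReal.inv_pow, ← ENNReal.inv_pow, ← div_eq_mul_inv,
    ENNReal.div_le_iff (by simp) (by simp), mul_right_comm, ← div_eq_mul_inv,
    ENNReal.le_div_iff_mul_le (by simp) (by simp)]
  exact_mod_cast Iff.rfl

/-! ### Binary strings -/

theorem primrec_two_pow : Primrec fun n : ℕ => 2 ^ n :=
  (Primrec₂.unpaired'.1 Nat.Primrec.pow).comp (.const 2) .id

theorem primrec_log_two : Primrec (Nat.log 2) := by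
  have h : Primrec fun n : ℕ => n.findGreatest fun k => 2 ^ k ≤ n :=
    Primrec.nat_findGreatest .id (Primrec.nat_le.comp (primrec_two_pow.comp .snd) .fst)
  refine h.of_eq fun n => ?_
  rcases eq_or_ne n 0 with rfl | hn
  · rfl
  · exact (Nat.findGreatest_eq_iff).2 ⟨Nat.log_le_self 2 n, fun _ => Nat.pow_log_le_self 2 hn,
      fun k hk _ => (Nat.lt_pow_of_log_lt one_lt_two hk).not_ge⟩

theorem primrec_testBit : Primrec₂ Nat.testBit := by
  have h : PrimrecRel fun v i : ℕ => v / 2 ^ i % 2 = 1 :=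
    Primrec.eq.comp (Primrec.nat_mod.comp
      (Primrec.nat_div.comp .fst (primrec_two_pow.comp .snd)) (.const 2)) (.const 1)
  exact h.decide.of_eq fun v i => Nat.testBit_eq_decide_div_mod_eq.symm

/-- The `n` lowest binary digits of `v`, most significant digit first, so that initial segments
correspond to dyadic intervals. -/
def binary (n v : ℕ) : List Bool := (List.range n).map fun i => v.testBit (n - 1 - i)

@[simp] theorem length_binary (n v : ℕ) : (binary n v).length = n := by simp [binary]

theorem primrec_binary : Primrec₂ binary :=
  Primrec.list_map (Primrec.list_range.comp .fst) <|
    primrec_testBit.comp (Primrec.snd.comp .fst) <| Primrec.nat_sub.comp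
      (Primrec.nat_sub.comp (Primrec.fst.comp .fst) (.const 1)) .snd

theorem eq_div_two_pow_of_binary_prefix {m n v w : ℕ} (hv : v < 2 ^ m) (hw : w < 2 ^ n)
    (h : binary m v <+: binary n w) : v = w / 2 ^ (n - m) := by
  have hmn : m ≤ n := by simpa using h.length_le
  refine Nat.eq_of_testBit_eq fun i => ?_
  rw [Nat.testBit_div_two_pow]
  rcases lt_or_ge i m with hi | hi
  · have h_digit := (List.prefix_iff_getElem.1 h).2 (m - 1 - i) (by rw [length_binary]; omega)
    simp only [binary, List.getElem_map, List.getElem_range] at h_digit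
    rwa [show m - 1 - (m - 1 - i) = i by omega,
      show n - 1 - (m - 1 - i) = i + (n - m) by omega] at h_digit
  · rw [Nat.testBit_lt_two_pow (hv.trans_le (Nat.pow_le_pow_right two_pos hi)),
      Nat.testBit_lt_two_pow (hw.trans_le (Nat.pow_le_pow_right two_pos (by omega)))]

theorem binary_injOn (n : ℕ) : Set.InjOn (binary n) (Set.Iio (2 ^ n)) := fun v hv w hw h => by
  simpa using eq_div_two_pow_of_binary_prefix hv hw (h ▸ List.prefix_rfl)

theorem exists_binary_eq (σ : List Bool) : ∃ v < 2 ^ σ.length, binary σ.length v = σ := by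
  refine ⟨Nat.ofBits fun i : Fin σ.length => σ[σ.length - 1 - i], Nat.ofBits_lt_two_pow _,
    List.ext_getElem (length_binary _ _) fun i h₁ h₂ => ?_⟩
  simp only [binary, List.getElem_map, List.getElem_range]
  rw [Nat.testBit_ofBits_lt _ _ (by omega)]
  congr 1
  simp only
  omega

/-- The binary strings of length `n`, as a list so that it can be computed. -/
def stringsOfLength (n : ℕ) : List (List Bool) := (List.range (2 ^ n)).map (binary n)

theorem mem_stringsOfLength {n : ℕ} {σ : List Bool} : σ ∈ stringsOfLength n ↔ σ.length = n := by
  simp only [stringsOfLength, List.mem_map, List.mem_range]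
  constructor
  · rintro ⟨v, -, rfl⟩
    exact length_binary n v
  · rintro rfl
    exact exists_binary_eq σ

theorem nodup_stringsOfLength (n : ℕ) : (stringsOfLength n).Nodup :=
  List.nodup_range.map_on fun _ hv _ hw =>
    binary_injOn n (List.mem_range.1 hv) (List.mem_range.1 hw)

@[simp] theorem length_stringsOfLength (n : ℕ) : (stringsOfLength n).length = 2 ^ n := by
  simp [stringsOfLength]

theorem primrec_stringsOfLength : Primrec stringsOfLength :=
  Primrec.list_map (Primrec.list_range.comp primrec_two_pow) (primrec_binary.comp .fst .snd)

/-! ### The Kraft–Chaitin theorem -/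

/-- The value of the `n`-th Kraft–Chaitin codeword, which has length `len n + 1`: reading the
codewords as dyadic intervals, each one is the leftmost interval of its length strictly to the
right of its predecessor. -/
def codeValue (len : ℕ → ℕ) : ℕ → ℕ
  | 0 => 0
  | n + 1 => (codeValue len n + 1) * 2 ^ len (n + 1) / 2 ^ len n + 1

theorem computable_codeValue {len : ℕ → ℕ} (hlen : Computable len) :
    Computable (codeValue len) := by
  have h_step : Primrec fun q : ℕ × ℕ × ℕ => (q.1 + 1) * 2 ^ q.2.1 / 2 ^ q.2.2 + 1 :=
    Primrec.succ.comp <| Primrec.nat_div.comp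
      (Primrec.nat_mul.comp (Primrec.succ.comp .fst)
        (primrec_two_pow.comp (Primrec.fst.comp .snd)))
      (primrec_two_pow.comp (Primrec.snd.comp .snd))
  have h_index : Computable fun p : ℕ × ℕ × ℕ => p.2.1 := Computable.fst.comp .snd
  refine (Computable.nat_rec .id (.const 0) (h_step.to_comp.comp
    ((Computable.snd.comp .snd).pair ((hlen.comp (Computable.succ.comp h_index)).pair
      (hlen.comp h_index)))).to₂).of_eq fun n => ?_
  induction n with
  | zero => rfl
  | succ n ih => simp_all [codeValue]

theorem codeValue_add_one_div_lt (len : ℕ → ℕ) (n : ℕ) :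
    (codeValue len n + 1 : ℝ) / 2 ^ (len n + 1)
      < codeValue len (n + 1) / 2 ^ (len (n + 1) + 1) := by
  have h : (codeValue len n + 1) * 2 ^ len (n + 1) < codeValue len (n + 1) * 2 ^ len n := by
    rw [codeValue, mul_comm _ (2 ^ len n)]
    exact Nat.lt_mul_div_succ _ (by positivity)
  have h_cast : (codeValue len n + 1 : ℝ) * 2 ^ len (n + 1)
      < codeValue len (n + 1) * 2 ^ len n := by exact_mod_cast h
  rw [div_lt_div_iff₀ (by positivity) (by positivity), pow_succ, pow_succ]
  linarith

theorem codeValue_add_one_div_le_sum (len : ℕ → ℕ) (n : ℕ) :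
    (codeValue len n + 1 : ℝ) / 2 ^ (len n + 1) ≤ ∑ i ∈ Finset.range (n + 1), 2⁻¹ ^ len i := by
  induction n with
  | zero =>
    rw [codeValue, Finset.sum_range_one, inv_pow, ← one_div]
    gcongr <;> simp
  | succ n ih =>
    have h_floor : (codeValue len (n + 1) : ℝ) ≤
        (codeValue len n + 1) * 2 ^ len (n + 1) / 2 ^ len n + 1 := by
      rw [codeValue]
      push_cast
      gcongr
      exact_mod_cast Nat.cast_div_le (α := ℝ)
    rw [Finset.sum_range_succ]
    calc (codeValue len (n + 1) + 1 : ℝ) / 2 ^ (len (n + 1) + 1)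
        ≤ ((codeValue len n + 1) * 2 ^ len (n + 1) / 2 ^ len n + 1 + 1)
          / 2 ^ (len (n + 1) + 1) := by gcongr
      _ = (codeValue len n + 1) / 2 ^ (len n + 1) + 2⁻¹ ^ len (n + 1) := by
        rw [inv_pow]; field_simp; ring
      _ ≤ _ := by gcongr

theorem codeValue_lt_two_pow {len : ℕ → ℕ} (h : ∑' n, (2⁻¹ : ℝ≥0∞) ^ len n ≤ 1) (n : ℕ) :
    codeValue len n < 2 ^ (len n + 1) := by
  have h_sum : ∑ i ∈ Finset.range (n + 1), (2⁻¹ : ℝ) ^ len i ≤ 1 := by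
    have h_ennreal := (ENNReal.sum_le_tsum (Finset.range (n + 1))).trans h
    rw [← ENNReal.toReal_le_toReal (ENNReal.sum_ne_top.2 fun i _ => by simp) ENNReal.one_ne_top,
      ENNReal.toReal_sum fun i _ => by simp] at h_ennreal
    simpa using h_ennreal
  have h_le := (codeValue_add_one_div_le_sum len n).trans h_sum
  rw [div_le_one (by positivity)] at h_le
  exact_mod_cast (lt_add_one _).trans_le h_le

theorem strictMono_codeValue_div (len : ℕ → ℕ) :
    StrictMono fun n => (codeValue len n : ℝ) / 2 ^ (len n + 1) :=
  strictMono_nat_of_lt_succ fun n =>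
    lt_of_le_of_lt (by gcongr; linarith) (codeValue_add_one_div_lt len n)

/-- The `n`-th codeword of the Kraft–Chaitin code for the sequence `len` of requested lengths. -/
def codeword (len : ℕ → ℕ) (n : ℕ) : List Bool := binary (len n + 1) (codeValue len n)

theorem computable_codeword {len : ℕ → ℕ} (hlen : Computable len) : Computable (codeword len) :=
  primrec_binary.to_comp.comp (Computable.succ.comp hlen) (computable_codeValue hlen)

theorem eq_of_codeword_prefix {len : ℕ → ℕ} (h : ∑' n, (2⁻¹ : ℝ≥0∞) ^ len n ≤ 1) {m n : ℕ}
    (hp : codeword len m <+: codeword len n) : m = n := by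
  obtain ⟨k, hk⟩ : ∃ k, len n = len m + k :=
    Nat.exists_eq_add_of_le (by simpa [codeword] using hp.length_le)
  have h_div : codeValue len m = codeValue len n / 2 ^ k := by
    have := eq_div_two_pow_of_binary_prefix (codeValue_lt_two_pow h m) (codeValue_lt_two_pow h n) hp
    rwa [hk, show len m + k + 1 - (len m + 1) = k by omega] at this
  have h_scale : (codeValue len n : ℝ) / 2 ^ (len n + 1)
      = codeValue len n / 2 ^ k / 2 ^ (len m + 1) := by
    rw [hk, div_div, ← pow_add]; ring_nf
  have h_left : (codeValue len m : ℝ) / 2 ^ (len m + 1) ≤ codeValue len n / 2 ^ (len n + 1) := by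
    rw [h_scale, h_div]
    gcongr
    exact_mod_cast Nat.cast_div_le (α := ℝ)
  have h_right : (codeValue len n : ℝ) / 2 ^ (len n + 1)
      < (codeValue len m + 1) / 2 ^ (len m + 1) := by
    rw [h_scale, h_div]
    gcongr
    rw [div_lt_iff₀' (by positivity)]
    exact_mod_cast Nat.lt_mul_div_succ _ (by positivity)
  have h_le : m ≤ n := (strictMono_codeValue_div len).le_iff_le.1 h_left
  refine h_le.eq_of_not_lt fun h_lt => h_right.not_gt ?_
  exact (codeValue_add_one_div_lt len m).trans_le
    ((strictMono_codeValue_div len).monotone h_lt)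

/-- The machine that describes `out n` by the `n`-th Kraft–Chaitin codeword for `len`. -/
def codeMachine (len : ℕ → ℕ) (out : ℕ → List Bool) (τ : List Bool) : Part (List Bool) :=
  (Nat.rfind fun n => Part.some (decide (codeword len n = τ))).map out

theorem mem_codeMachine_codeword {len : ℕ → ℕ} (h : ∑' n, (2⁻¹ : ℝ≥0∞) ^ len n ≤ 1)
    (out : ℕ → List Bool) (n : ℕ) : out n ∈ codeMachine len out (codeword len n) := by
  refine Part.mem_map out (Nat.mem_rfind.2 ⟨by simp, fun {m} hm => ?_⟩)
  have : codeword len m ≠ codeword len n := fun h_eq =>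
    hm.ne (eq_of_codeword_prefix h (h_eq ▸ List.prefix_rfl))
  simpa using this

theorem isPrefixFreeMachine_codeMachine {len : ℕ → ℕ} {out : ℕ → List Bool}
    (hlen : Computable len) (hout : Computable out) (h : ∑' n, (2⁻¹ : ℝ≥0∞) ^ len n ≤ 1) :
    IsPrefixFreeMachine (codeMachine len out) where
  partrec := by
    have h_eq : Computable₂ fun τ n => decide (codeword len n = τ) :=
      Primrec.eq.decide.to_comp.comp ((computable_codeword hlen).comp .snd) .fst
    exact (Partrec.rfind h_eq.partrec₂).map (hout.comp .snd).to₂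
  prefixFree σ τ hσ hτ hp := by
    have h_code {τ : List Bool} (hτ : (codeMachine len out τ).Dom) : ∃ n, codeword len n = τ := by
      obtain ⟨_, h_mem⟩ := Part.dom_iff_mem.1 hτ
      obtain ⟨n, hn, -⟩ := (Part.mem_map_iff _).1 h_mem
      exact ⟨n, by simpa using Nat.rfind_spec hn⟩
    obtain ⟨m, rfl⟩ := h_code hσ
    obtain ⟨n, rfl⟩ := h_code hτ
    rw [eq_of_codeword_prefix h hp]

theorem K_le_length {M : List Bool →. List Bool} {τ σ : List Bool} (h : σ ∈ M τ) :
    K M σ ≤ τ.length := iInf₂_le τ h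

theorem IsUniversal.exists_K_le_add {U : List Bool →. List Bool} (hU : IsUniversal U)
    {len : ℕ → ℕ} {out : ℕ → List Bool} (hlen : Computable len) (hout : Computable out)
    (h : ∑' n, (2⁻¹ : ℝ≥0∞) ^ len n ≤ 1) : ∃ c, ∀ n, K U (out n) ≤ (len n + c : ℕ) := by
  obtain ⟨c, hc⟩ := hU.simulates _ (isPrefixFreeMachine_codeMachine hlen hout h)
  refine ⟨c + 1, fun n => ?_⟩
  obtain ⟨τ, hτ, hle⟩ := hc _ _ (mem_codeMachine_codeword h out n)
  rw [codeword, length_binary] at hle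
  exact (K_le_length hτ).trans (by exact_mod_cast (by omega : τ.length ≤ len n + (c + 1)))

theorem tsum_decode₂_bind_elim {P β : Type*} [Encodable P] (f : P → Option β) (w : β → ℝ≥0∞) :
    ∑' n, ((decode₂ P n).bind f).elim 0 w = ∑' p, (f p).elim 0 w := by
  rw [← (encode_injective (α := P)).tsum_eq]
  · simp only [encodek₂, Option.bind_some]
  · intro n hn
    rcases h : decode₂ P n with _ | p
    · simp [h] at hn
    · exact ⟨p, mem_decode₂.1 h⟩

theorem tsum_getElem?_elim {β : Type*} (l : List β) (w : ℝ≥0∞) :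
    ∑' i : ℕ, l[i]?.elim 0 (fun _ => w) = l.length * w := by
  have h_out (i : ℕ) (hi : i ∉ Finset.range l.length) : l[i]?.elim 0 (fun _ => w) = 0 := by
    rw [List.getElem?_eq_none (by simpa using hi), Option.elim_none]
  have h_in (i : ℕ) (hi : i ∈ Finset.range l.length) : l[i]?.elim 0 (fun _ => w) = w := by
    rw [List.getElem?_eq_getElem (Finset.mem_range.1 hi), Option.elim_some]
  rw [tsum_eq_sum h_out, Finset.sum_congr rfl h_in, Finset.sum_const, Finset.card_range,
    nsmul_eq_mul]

theorem IsUniversal.exists_K_le_add_of_request {U : List Bool →. List Bool} (hU : IsUniversal U)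
    {P : Type*} [Primcodable P] {request : P → Option (ℕ × List Bool)}
    (h_computable : Computable request)
    (h_kraft : ∑' p, (request p).elim 0 (fun r => (2⁻¹ : ℝ≥0∞) ^ r.1) ≤ 1) :
    ∃ c, ∀ p, ∀ r ∈ request p, K U r.2 ≤ (r.1 + c : ℕ) := by
  let entry (n : ℕ) : Option (ℕ × List Bool) := (decode₂ P n).bind request
  have h_entry : Computable entry :=
    Computable.option_bind Primrec.decode₂.to_comp (h_computable.comp .snd)
  -- The indices without a request consume `∑ 2⁻¹ ^ (n + 2) = 1 / 2` of the available measure.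
  let len (n : ℕ) : ℕ := ((entry n).map fun r => r.1 + 1).getD (n + 2)
  let out (n : ℕ) : List Bool := ((entry n).map Prod.snd).getD []
  have h_len : Computable len := Computable.option_getD (Computable.option_map h_entry
    (Computable.succ.comp (Computable.fst.comp .snd)).to₂) (Computable.succ.comp .succ)
  have h_out : Computable out := Computable.option_getD
    (Computable.option_map h_entry (Computable.snd.comp .snd).to₂) (.const [])
  have h_sum : ∑' n, (2⁻¹ : ℝ≥0∞) ^ len n ≤ 1 := calc
    ∑' n, (2⁻¹ : ℝ≥0∞) ^ len n
        ≤ ∑' n, (2⁻¹ ^ (n + 1) * 2⁻¹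
          + (entry n).elim 0 (fun r => (2⁻¹ : ℝ≥0∞) ^ r.1) * 2⁻¹) := by
      gcongr with n
      cases h : entry n <;> simp [len, h, pow_succ]
    _ = 2⁻¹ + (∑' p, (request p).elim 0 fun r => (2⁻¹ : ℝ≥0∞) ^ r.1) * 2⁻¹ := by
      rw [ENNReal.tsum_add, ENNReal.tsum_mul_right, ENNReal.tsum_mul_right,
        tsum_decode₂_bind_elim, tsum_inv_two_pow_succ, one_mul]
    _ ≤ 2⁻¹ + 1 * 2⁻¹ := by gcongr
    _ = 1 := by rw [one_mul, ENNReal.inv_two_add_inv_two]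
  obtain ⟨c, hc⟩ := hU.exists_K_le_add h_len h_out h_sum
  refine ⟨c + 1, fun p r hr => ?_⟩
  have h_encode : entry (encode p) = some r := by
    simpa [entry] using hr
  simpa only [len, out, h_encode, Option.map_some, Option.getD_some, add_assoc, add_comm 1]
    using hc (encode p)

theorem IsUniversal.exists_K_le_add_of_list {U : List Bool →. List Bool} (hU : IsUniversal U)
    {P : Type*} [Primcodable P] {S : P → List (List Bool)} {len : P → ℕ} (hS : Computable S)
    (h_len : Computable len) (h_kraft : ∑' p, (S p).length * (2⁻¹ : ℝ≥0∞) ^ len p ≤ 1) :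
    ∃ c, ∀ p, ∀ σ ∈ S p, K U σ ≤ (len p + c : ℕ) := by
  have h_request : Computable fun q : P × ℕ => (S q.1)[q.2]?.map fun σ => (len q.1, σ) :=
    Computable.option_map (Computable.list_getElem?.comp (hS.comp .fst) .snd)
      (((h_len.comp .fst).comp .fst).pair .snd)
  obtain ⟨c, hc⟩ := hU.exists_K_le_add_of_request h_request <| by
    simpa only [ENNReal.tsum_prod', Option.elim_map, Function.comp_def, tsum_getElem?_elim]
      using h_kraft
  refine ⟨c, fun p σ hσ => ?_⟩
  obtain ⟨i, hi⟩ := List.mem_iff_getElem?.1 hσ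
  exact hc (p, i) (len p, σ) (by simp [hi])

theorem notMem_randomStrings {U : List Bool →. List Bool} {σ : List Bool} :
    σ ∉ randomStrings U ↔ K U σ < σ.length :=
  not_le (a := (σ.length : ℕ∞))

/-- Descriptions of length `n p - d p` are affordable: those of the strings in `S p` have total
measure at most `2⁻¹ ^ ℓ p`. -/
theorem IsUniversal.exists_notMem_randomStrings {U : List Bool →. List Bool} (hU : IsUniversal U)
    {P : Type*} [Primcodable P] {S : P → List (List Bool)} {n d ℓ : P → ℕ} (hS : Computable S)
    (hn : Computable n) (hd : Computable d) (h_length : ∀ p, ∀ σ ∈ S p, σ.length = n p)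
    (h_card : ∀ p, (S p).length * 2 ^ (d p + ℓ p) ≤ 2 ^ n p)
    (h_kraft : ∑' p : {p // S p ≠ []}, (2⁻¹ : ℝ≥0∞) ^ ℓ p ≤ 1) :
    ∃ c, ∀ p, c < d p → ∀ σ ∈ S p, σ ∉ randomStrings U := by
  have h_le (p : P) (hp : S p ≠ []) : d p + ℓ p ≤ n p := by
    rw [← Nat.pow_le_pow_iff_right one_lt_two]
    exact (Nat.le_mul_of_pos_left _ (List.length_pos_iff.2 hp)).trans (h_card p)
  have h_sum : ∑' p, (S p).length * (2⁻¹ : ℝ≥0∞) ^ (n p - d p) ≤ 1 := by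
    refine le_trans ?_ h_kraft
    refine le_of_le_of_eq ?_ (tsum_subtype {p | S p ≠ []} fun p => (2⁻¹ : ℝ≥0∞) ^ ℓ p).symm
    refine ENNReal.tsum_le_tsum fun p => ?_
    by_cases hp : S p = []
    · simp [hp]
    · rw [Set.indicator_of_mem hp]
      suffices h : (S p).length * 2 ^ ℓ p ≤ 1 * 2 ^ (n p - d p) by
        simpa only [Nat.cast_one, one_mul] using natCast_mul_inv_two_pow_le_iff.2 h
      rw [one_mul]
      refine Nat.le_of_mul_le_mul_left (c := 2 ^ d p) ?_ (by positivity)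
      calc 2 ^ d p * ((S p).length * 2 ^ ℓ p) = (S p).length * 2 ^ (d p + ℓ p) := by ring
        _ ≤ 2 ^ n p := h_card p
        _ = 2 ^ d p * 2 ^ (n p - d p) := by rw [← pow_add]; have := h_le p hp; congr 1; omega
  obtain ⟨c, hc⟩ := hU.exists_K_le_add_of_list hS (Primrec.nat_sub.to_comp.comp hn hd) h_sum
  refine ⟨c, fun p hcd σ hσ => notMem_randomStrings.2 ((hc p σ hσ).trans_lt ?_)⟩
  have := h_le p (List.ne_nil_of_mem hσ)
  rw [h_length p σ hσ]
  exact_mod_cast (by omega : n p - d p + c < n p)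

/-! ### Enumerating the nonrandom strings -/

theorem exists_primrec_stages {α β : Type*} [Primcodable α] [Primcodable β] {f : α →. β}
    (hf : Partrec f) : ∃ g : α → ℕ → Option β, Primrec₂ g ∧
      (∀ a s t b, s ≤ t → b ∈ g a s → b ∈ g a t) ∧ ∀ a b, b ∈ f a ↔ ∃ s, b ∈ g a s := by
  obtain ⟨c, hc⟩ := Nat.Partrec.Code.exists_code.1 hf
  refine ⟨fun a s => (c.evaln s (encode a)).bind decode, ?_, fun a s t b hst hb => ?_,
    fun a b => ?_⟩
  · exact Primrec.option_bind (Nat.Partrec.Code.primrec_evaln.comp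
      ((Primrec.snd.pair (.const c)).pair (Primrec.encode.comp .fst))) (Primrec.decode.comp .snd)
  · obtain ⟨n, hn, h_decode⟩ := Option.bind_eq_some_iff.1 hb
    exact Option.bind_eq_some_iff.2 ⟨n, Nat.Partrec.Code.evaln_mono hst hn, h_decode⟩
  · have h_eval (n : ℕ) : n ∈ c.eval (encode a) ↔ ∃ b ∈ f a, encode b = n := by simp [hc]
    simp only [Option.mem_def, Option.bind_eq_some_iff]
    constructor
    · intro hb
      obtain ⟨s, hs⟩ := Nat.Partrec.Code.evaln_complete.1 ((h_eval _).2 ⟨b, hb, rfl⟩)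
      exact ⟨s, encode b, hs, encodek b⟩
    · rintro ⟨s, n, hn, h_decode⟩
      obtain ⟨b', hb', rfl⟩ := (h_eval n).1 (Nat.Partrec.Code.evaln_sound hn)
      rwa [← Option.some.inj ((encodek b').symm.trans h_decode)]

theorem K_lt_iff {M : List Bool →. List Bool} {σ : List Bool} {n : ℕ∞} :
    K M σ < n ↔ ∃ τ, σ ∈ M τ ∧ τ.length < n := by
  simp only [K, iInf_lt_iff, exists_prop]

/-- An approximation of the nonrandom strings of `U` from below: `g σ t = true` means that `σ` is
known to be nonrandom at stage `t`. -/
structure EnumeratesNonrandom (g : List Bool → ℕ → Bool) (U : List Bool →. List Bool) : Prop where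
  primrec : Primrec₂ g
  mono : ∀ σ s t, s ≤ t → g σ s → g σ t
  exists_stage_iff : ∀ σ, (∃ t, g σ t) ↔ σ ∉ randomStrings U

theorem exists_enumeratesNonrandom {U : List Bool →. List Bool} (hU : Partrec U) :
    ∃ g, EnumeratesNonrandom g U := by
  obtain ⟨f, hf, hf_mono, hf_mem⟩ := exists_primrec_stages hU
  let shorter (σ : List Bool) : List (List Bool) :=
    (List.range σ.length).flatMap stringsOfLength
  have h_shorter : Primrec shorter := Primrec.list_flatMap
    (Primrec.list_range.comp .list_length) (primrec_stringsOfLength.comp .snd)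
  have h_mem (τ σ : List Bool) : τ ∈ shorter σ ↔ τ.length < σ.length := by
    simp [shorter, mem_stringsOfLength]
  have h_rel : PrimrecRel fun (τ : List Bool) (q : List Bool × ℕ) => f τ q.2 = some q.1 :=
    Primrec.eq.comp (hf.comp .fst (Primrec.snd.comp .snd))
      (Primrec.option_some.comp (Primrec.fst.comp .snd))
  refine ⟨fun σ t => decide (∃ τ ∈ shorter σ, f τ t = some σ), ?_, fun σ s t hst => ?_, fun σ => ?_⟩
  · exact (h_rel.exists_mem_list.comp (h_shorter.comp .fst) .id).decide
  · simp only [decide_eq_true_eq]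
    exact fun ⟨τ, hτ, hs⟩ => ⟨τ, hτ, hf_mono τ s t σ hst hs⟩
  · rw [notMem_randomStrings, K_lt_iff]
    simp only [decide_eq_true_eq, h_mem, hf_mem, Option.mem_def, Nat.cast_lt]
    exact ⟨fun ⟨t, τ, hτ, ht⟩ => ⟨τ, ⟨t, ht⟩, hτ⟩, fun ⟨τ, ⟨t, ht⟩, hτ⟩ => ⟨t, τ, hτ, ht⟩⟩

open Classical in
/-- The number of strings of length `n` that are not random with respect to `U`. -/
noncomputable def nonrandomCount (U : List Bool →. List Bool) (n : ℕ) : ℕ :=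
  (stringsOfLength n).countP fun σ => decide (σ ∉ randomStrings U)

/-- The number of strings of length `n` that the enumeration `g` has produced by stage `t`. -/
def stageCount (g : List Bool → ℕ → Bool) (n t : ℕ) : ℕ :=
  (stringsOfLength n).countP fun σ => g σ t

theorem primrec_countP {α β : Type*} [Primcodable α] [Primcodable β] {p : α → β → Bool}
    (hp : Primrec₂ p) : Primrec₂ fun (l : List α) (b : β) => l.countP fun a => p a b := by
  have h_rel : PrimrecRel fun a b => p a b = true := Primrec.eq.comp hp (.const true)
  refine (Primrec.list_length.comp h_rel.listFilter).of_eq fun q => ?_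
  simp [List.countP_eq_length_filter]

theorem primrec_stageCount {g : List Bool → ℕ → Bool} (hg : Primrec₂ g) :
    Primrec₂ (stageCount g) :=
  (primrec_countP hg).comp (primrec_stringsOfLength.comp .fst) .snd

namespace EnumeratesNonrandom

variable {g : List Bool → ℕ → Bool} {U : List Bool →. List Bool}

theorem monotone_stageCount (hg : EnumeratesNonrandom g U) (n : ℕ) : Monotone (stageCount g n) :=
  fun s t hst => List.countP_mono_left fun σ _ => hg.mono σ s t hst

theorem stageCount_le (hg : EnumeratesNonrandom g U) (n t : ℕ) :
    stageCount g n t ≤ nonrandomCount U n := by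
  classical
  exact List.countP_mono_left fun σ _ h => decide_eq_true ((hg.exists_stage_iff σ).1 ⟨t, h⟩)

theorem eventually_stageCount_eq (hg : EnumeratesNonrandom g U) (n : ℕ) :
    ∀ᶠ t in atTop, stageCount g n t = nonrandomCount U n := by
  classical
  have h_string (σ : List Bool) : ∀ᶠ t in atTop, (g σ t = true ↔ σ ∉ randomStrings U) := by
    by_cases hσ : σ ∈ randomStrings U
    · have h_never := not_exists.1 (mt (hg.exists_stage_iff σ).1 (not_not.2 hσ))
      exact .of_forall fun t => iff_of_false (h_never t) (not_not.2 hσ)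
    · obtain ⟨s, hs⟩ := (hg.exists_stage_iff σ).2 hσ
      filter_upwards [eventually_ge_atTop s] with t ht
      exact iff_of_true (hg.mono σ s t ht hs) hσ
  filter_upwards [(eventually_all_finset (stringsOfLength n).toFinset).2 fun σ _ => h_string σ]
    with t ht
  refine List.countP_congr fun σ hσ => ?_
  rw [decide_eq_true_iff]
  exact ht σ (List.mem_toFinset.2 hσ)

end EnumeratesNonrandom

theorem tsum_inv_two_pow_length_nonrandom_le {U : List Bool →. List Bool}
    (hU : IsPrefixFreeMachine U) : ∑' σ : ↥(randomStrings U)ᶜ, (2⁻¹ : ℝ≥0∞) ^ σ.1.length ≤ 2⁻¹ := by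
  have h_short (σ : ↥(randomStrings U)ᶜ) : ∃ τ, σ.1 ∈ U τ ∧ τ.length < σ.1.length := by
    simpa using K_lt_iff.1 (notMem_randomStrings.1 σ.2)
  choose descr h_mem h_lt using h_short
  let D : Set (List Bool) := {τ | (U τ).Dom}
  have h_antichain : IsAntichain (· <+: ·) D := fun σ hσ τ hτ h_ne hp =>
    h_ne (hU.prefixFree σ τ hσ hτ hp)
  let descr' (σ : ↥(randomStrings U)ᶜ) : D := ⟨descr σ, Part.dom_iff_mem.2 ⟨σ, h_mem σ⟩⟩
  have h_inj : Function.Injective descr' := fun σ τ h => by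
    have h_descr : descr σ = descr τ := congrArg Subtype.val h
    exact Subtype.ext (Part.mem_unique (h_mem σ) (h_descr ▸ h_mem τ))
  calc ∑' σ : ↥(randomStrings U)ᶜ, (2⁻¹ : ℝ≥0∞) ^ σ.1.length
      ≤ ∑' σ : ↥(randomStrings U)ᶜ, 2⁻¹ * (2⁻¹ : ℝ≥0∞) ^ (descr' σ).1.length := by
        gcongr with σ
        rw [← pow_succ']
        exact pow_le_pow_right_of_le_one' (by simp) (h_lt σ)
    _ ≤ 2⁻¹ * ∑' τ : D, (2⁻¹ : ℝ≥0∞) ^ τ.1.length := by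
        rw [ENNReal.tsum_mul_left]
        gcongr
        exact ENNReal.tsum_comp_le_tsum_of_injective h_inj fun τ : D => (2⁻¹ : ℝ≥0∞) ^ τ.1.length
    _ ≤ 2⁻¹ * 1 := by gcongr; exact tsum_inv_two_pow_length_le_one_of_isAntichain h_antichain
    _ = 2⁻¹ := mul_one _

theorem tsum_nonrandomCount_le {U : List Bool →. List Bool} (hU : IsPrefixFreeMachine U) :
    ∑' n, nonrandomCount U n * (2⁻¹ : ℝ≥0∞) ^ n ≤ 2⁻¹ := by
  classical
  refine le_trans (le_of_eq ?_) (tsum_inv_two_pow_length_nonrandom_le hU)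
  rw [tsum_subtype (randomStrings U)ᶜ fun σ => (2⁻¹ : ℝ≥0∞) ^ σ.length,
    ← ENNReal.tsum_fiberwise _ List.length]
  congr 1 with n
  have h_fiber : List.length ⁻¹' {n} = ((stringsOfLength n).toFinset : Set (List Bool)) := by
    ext σ; simp [mem_stringsOfLength]
  rw [h_fiber, Finset.tsum_subtype', Finset.sum_congr rfl fun σ hσ => by
    rw [Set.indicator_apply, (mem_stringsOfLength.1 (List.mem_toFinset.1 hσ))]]
  rw [← Finset.sum_filter, Finset.sum_const, nsmul_eq_mul, nonrandomCount,
    List.countP_eq_length_filter,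
    ← List.toFinset_card_of_nodup ((nodup_stringsOfLength n).filter _), List.toFinset_filter]
  simp

theorem two_mul_nonrandomCount_le {U : List Bool →. List Bool} (hU : IsPrefixFreeMachine U)
    (n : ℕ) : 2 * nonrandomCount U n ≤ 2 ^ n := by
  have h : nonrandomCount U n * (2⁻¹ : ℝ≥0∞) ^ n ≤ (1 : ℕ) * 2⁻¹ ^ 1 :=
    ((ENNReal.le_tsum n).trans (tsum_nonrandomCount_le hU)).trans_eq (by simp)
  simpa [mul_comm] using natCast_mul_inv_two_pow_le_iff.1 h

/-! ### Forcing strings to be nonrandom -/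

/-- The strings of length `n` that the enumeration `g` has not produced by stage `t`. -/
def freshStrings (g : List Bool → ℕ → Bool) (n t : ℕ) : List (List Bool) :=
  (stringsOfLength n).filter fun σ => !g σ t

theorem primrec_freshStrings {g : List Bool → ℕ → Bool} (hg : Primrec₂ g) :
    Primrec₂ (freshStrings g) := by
  have h_rel : PrimrecRel fun σ t => g σ t = false := Primrec.eq.comp hg (.const false)
  refine (h_rel.listFilter.comp (primrec_stringsOfLength.comp .fst) .snd).of_eq fun q => ?_
  simp [freshStrings]

theorem length_of_mem_freshStrings {g : List Bool → ℕ → Bool} {n t : ℕ} {σ : List Bool}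
    (hσ : σ ∈ freshStrings g n t) : σ.length = n :=
  mem_stringsOfLength.1 (List.mem_of_mem_filter hσ)

theorem stageCount_add_length_freshStrings (g : List Bool → ℕ → Bool) (n t : ℕ) :
    stageCount g n t + (freshStrings g n t).length = 2 ^ n := by
  rw [stageCount, freshStrings, ← List.countP_eq_length_filter, ← length_stringsOfLength n,
    List.length_eq_countP_add_countP fun σ => g σ t]
  simp

theorem EnumeratesNonrandom.stageCount_add_le {g : List Bool → ℕ → Bool}
    {U : List Bool →. List Bool} (hg : EnumeratesNonrandom g U) {n t m : ℕ}
    (hm : m ≤ (freshStrings g n t).length)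
    (h : ∀ σ ∈ (freshStrings g n t).take m, σ ∉ randomStrings U) :
    stageCount g n t + m ≤ nonrandomCount U n := by
  classical
  rw [nonrandomCount, List.countP_eq_countP_filter_add _ _ fun σ => g σ t]
  gcongr
  · rw [stageCount, List.countP_filter]
    refine List.countP_mono_left fun σ _ hσ => ?_
    simpa [hσ] using (hg.exists_stage_iff σ).1 ⟨t, hσ⟩
  · calc m = ((freshStrings g n t).take m).countP fun σ => decide (σ ∉ randomStrings U) := by
          rw [List.countP_eq_length.2 fun σ hσ => decide_eq_true (h σ hσ), List.length_take,
            min_eq_left hm]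
      _ ≤ _ := (List.take_sublist m _).countP_le

theorem exists_not_and_succ {p : ℕ → Prop} {t : ℕ} (ht : ¬ p t) (h_mono : Monotone p)
    (hp : ∃ s, p s) : ∃ s ≥ t, ¬ p s ∧ p (s + 1) := by
  obtain ⟨s, hs⟩ := hp
  obtain ⟨k, hk⟩ := Nat.exists_not_and_succ_of_not_zero_of_exists (p := fun n => p (t + n)) ht
    ⟨s, h_mono (Nat.le_add_left s t) hs⟩
  exact ⟨t + k, Nat.le_add_right t k, hk⟩

/-- The number of strings of length `x` that a universal machine can be made to compress by more
than `a` bits, at a cost of `2⁻¹ ^ (a + 1 + Nat.log 2 x)` in measure. -/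
def gap (a x : ℕ) : ℕ := 2 ^ x / 2 ^ (2 * a + 2 + Nat.log 2 x)

theorem primrec_gap : Primrec₂ gap :=
  Primrec.nat_div.comp (primrec_two_pow.comp .snd) <| primrec_two_pow.comp <|
    Primrec.nat_add.comp (Primrec.nat_add.comp (Primrec.nat_mul.comp (.const 2) .fst) (.const 2))
      (primrec_log_two.comp .snd)

theorem two_mul_gap_le (a x : ℕ) : 2 * gap a x ≤ 2 ^ x := by
  refine le_trans ?_ (Nat.div_mul_le_self (2 ^ x) (2 ^ (2 * a + 2 + Nat.log 2 x)))
  rw [mul_comm, gap]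
  gcongr
  exact le_self_pow one_le_two (by omega)

/-- The strings of length `x` to be compressed when `L x` becomes true right after stage `t`. -/
def eventStrings (L : ℕ → ℕ → Prop) [DecidableRel L] (g : List Bool → ℕ → Bool)
    (p : ℕ × ℕ × ℕ) : List (List Bool) :=
  if ¬ L p.2.1 p.2.2 ∧ L p.2.1 (p.2.2 + 1) then
    (freshStrings g p.2.1 p.2.2).take (gap p.1 p.2.1)
  else []

section

variable {L : ℕ → ℕ → Prop} [DecidableRel L]

theorem primrec_eventStrings {g : List Bool → ℕ → Bool} (hL : PrimrecRel L) (hg : Primrec₂ g) :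
    Primrec (eventStrings L g) := by
  have h_length : Primrec fun p : ℕ × ℕ × ℕ => p.2.1 := Primrec.fst.comp .snd
  have h_stage : Primrec fun p : ℕ × ℕ × ℕ => p.2.2 := Primrec.snd.comp .snd
  exact Primrec.ite
    ((hL.comp h_length h_stage).not.and (hL.comp h_length (Primrec.succ.comp h_stage)))
    (Primrec.list_take.comp (primrec_gap.comp .fst h_length)
      ((primrec_freshStrings hg).comp h_length h_stage)) (.const [])

theorem tsum_eventStrings_le (h_mono : ∀ x, Monotone (L x))
    (h_kraft : ∑' x : {x | ∃ t, L x t}, (2⁻¹ : ℝ≥0∞) ^ Nat.log 2 x ≤ 1)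
    (g : List Bool → ℕ → Bool) :
    ∑' p : {p // eventStrings L g p ≠ []}, (2⁻¹ : ℝ≥0∞) ^ (p.1.1 + 1 + Nat.log 2 p.1.2.1) ≤ 1 := by
  have h_event {p : ℕ × ℕ × ℕ} (hp : eventStrings L g p ≠ []) :
      ¬ L p.2.1 p.2.2 ∧ L p.2.1 (p.2.2 + 1) := (ite_ne_right_iff.1 hp).1
  let toLength (p : {p // eventStrings L g p ≠ []}) : ℕ × {x | ∃ t, L x t} :=
    (p.1.1, ⟨p.1.2.1, _, (h_event p.2).2⟩)
  have h_inj : Function.Injective toLength := by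
    rintro ⟨⟨a, x, s⟩, hs⟩ ⟨⟨a', x', t⟩, ht⟩ h
    obtain ⟨rfl, rfl⟩ : a = a' ∧ x = x' := by simpa [toLength] using h
    rcases lt_trichotomy s t with h_lt | rfl | h_lt
    · exact absurd (h_mono x h_lt (h_event hs).2) (h_event ht).1
    · rfl
    · exact absurd (h_mono x h_lt (h_event ht).2) (h_event hs).1
  calc ∑' p : {p // eventStrings L g p ≠ []}, (2⁻¹ : ℝ≥0∞) ^ (p.1.1 + 1 + Nat.log 2 p.1.2.1)
      ≤ ∑' q : ℕ × {x | ∃ t, L x t}, (2⁻¹ : ℝ≥0∞) ^ (q.1 + 1 + Nat.log 2 q.2) :=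
        ENNReal.tsum_comp_le_tsum_of_injective h_inj
          fun q => (2⁻¹ : ℝ≥0∞) ^ (q.1 + 1 + Nat.log 2 q.2)
    _ = ∑' x : {x | ∃ t, L x t}, (2⁻¹ : ℝ≥0∞) ^ Nat.log 2 x := by
        simp_rw [ENNReal.tsum_prod', pow_add _ (_ + 1), ENNReal.tsum_mul_left,
          ENNReal.tsum_mul_right, tsum_inv_two_pow_succ, one_mul]
    _ ≤ 1 := h_kraft

end

theorem IsUniversal.exists_stageCount_add_gap_le {U : List Bool →. List Bool} (hU : IsUniversal U)
    {g : List Bool → ℕ → Bool} (hg : EnumeratesNonrandom g U) {L : ℕ → ℕ → Prop}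
    (hL : PrimrecRel L) (h_mono : ∀ x, Monotone (L x))
    (h_kraft : ∑' x : {x | ∃ t, L x t}, (2⁻¹ : ℝ≥0∞) ^ Nat.log 2 x ≤ 1) :
    ∃ c, ∀ a ≥ c, ∀ x t, ¬ L x t → (∃ s, L x s) →
      stageCount g x t + gap a x ≤ nonrandomCount U x := by
  classical
  have h_length (p : ℕ × ℕ × ℕ) : ∀ σ ∈ eventStrings L g p, σ.length = p.2.1 := by
    intro σ hσ
    rw [eventStrings, List.mem_ite_nil_right] at hσ
    exact length_of_mem_freshStrings (List.mem_of_mem_take hσ.2)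
  have h_card (p : ℕ × ℕ × ℕ) :
      (eventStrings L g p).length * 2 ^ (p.1 + 1 + (p.1 + 1 + Nat.log 2 p.2.1)) ≤ 2 ^ p.2.1 := by
    have h_le_gap : (eventStrings L g p).length ≤ gap p.1 p.2.1 := by
      rw [eventStrings]; split_ifs <;> simp
    rw [show p.1 + 1 + (p.1 + 1 + Nat.log 2 p.2.1) = 2 * p.1 + 2 + Nat.log 2 p.2.1 by ring]
    exact (Nat.mul_le_mul_right _ h_le_gap).trans (Nat.div_mul_le_self _ _)
  have h_excess : Computable fun p : ℕ × ℕ × ℕ => p.1 + 1 := Computable.succ.comp .fst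
  obtain ⟨c, hc⟩ := hU.exists_notMem_randomStrings (n := fun p => p.2.1) (d := fun p => p.1 + 1)
    (ℓ := fun p => p.1 + 1 + Nat.log 2 p.2.1) (primrec_eventStrings hL hg.primrec).to_comp
    (Computable.fst.comp .snd) h_excess h_length h_card
    (tsum_eventStrings_le h_mono h_kraft g)
  refine ⟨c, fun a ha x t ht hx => ?_⟩
  obtain ⟨s, hts, h_event⟩ := exists_not_and_succ ht (h_mono x) hx
  have h_room : gap a x ≤ (freshStrings g x s).length := by
    have h_total := stageCount_add_length_freshStrings g x s
    have h_half := (Nat.mul_le_mul_left 2 (hg.stageCount_le x s)).trans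
      (two_mul_nonrandomCount_le hU.machine x)
    have h_gap := two_mul_gap_le a x
    omega
  calc stageCount g x t + gap a x ≤ stageCount g x s + gap a x := by
        gcongr; exact hg.monotone_stageCount x hts
    _ ≤ nonrandomCount U x := hg.stageCount_add_le h_room fun σ hσ =>
        hc (a, x, s) (Nat.lt_succ_of_le ha) σ (by rwa [eventStrings, if_pos h_event])

theorem IsUniversal.exists_div_le_nonrandomCount {U : List Bool →. List Bool} (hU : IsUniversal U)
    {x : ℕ → ℕ} (hx : Computable x) :
    ∃ c, ∀ a ≥ c, 2 ^ x a / 2 ^ (2 * a + 2) ≤ nonrandomCount U (x a) := by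
  classical
  let m (a : ℕ) : ℕ := 2 ^ x a / 2 ^ (2 * a + 2)
  have h_le (a : ℕ) : m a ≤ 2 ^ x a := Nat.div_le_self _ _
  have hm : Computable m := Primrec.nat_div.to_comp.comp (primrec_two_pow.to_comp.comp hx)
    (primrec_two_pow.comp
      (Primrec.nat_add.comp (Primrec.nat_mul.comp (.const 2) .id) (.const 2))).to_comp
  let S (a : ℕ) : List (List Bool) := (stringsOfLength (x a)).take (m a)
  have hS : Computable S :=
    Primrec.list_take.to_comp.comp hm (primrec_stringsOfLength.to_comp.comp hx)
  have h_length (a : ℕ) : (S a).length = m a := by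
    rw [List.length_take, length_stringsOfLength, min_eq_left (h_le a)]
  have h_card (a : ℕ) : (S a).length * 2 ^ (a + 1 + (a + 1)) ≤ 2 ^ x a := by
    rw [h_length, show a + 1 + (a + 1) = 2 * a + 2 by ring]
    exact Nat.div_mul_le_self _ _
  have h_kraft : ∑' a : {a // S a ≠ []}, (2⁻¹ : ℝ≥0∞) ^ (a.1 + 1) ≤ 1 := calc
    _ ≤ ∑' a : ℕ, (2⁻¹ : ℝ≥0∞) ^ (a + 1) := ENNReal.tsum_comp_le_tsum_of_injective
        Subtype.val_injective fun a => (2⁻¹ : ℝ≥0∞) ^ (a + 1)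
    _ = 1 := tsum_inv_two_pow_succ
  obtain ⟨c, hc⟩ := hU.exists_notMem_randomStrings (d := fun a => a + 1) (ℓ := fun a => a + 1)
    hS hx .succ (fun a σ hσ => mem_stringsOfLength.1 (List.mem_of_mem_take hσ)) h_card h_kraft
  refine ⟨c, fun a ha => ?_⟩
  calc m a = (S a).countP fun σ => decide (σ ∉ randomStrings U) := by
        rw [List.countP_eq_length.2 fun σ hσ => decide_eq_true (hc a (Nat.lt_succ_of_le ha) σ hσ),
          h_length]
    _ ≤ _ := (List.take_sublist _ _).countP_le

theorem IsUniversal.exists_mul_two_pow_le_nonrandomCount {U : List Bool →. List Bool}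
    (hU : IsUniversal U) {x : ℕ → ℕ} (hx : Computable x) {n : ℕ} (hn : n ≠ 0)
    (h : ∀ k, n * 2 ^ (2 * k + 2) ≤ 2 ^ Nat.log 2 (x k)) :
    ∃ k, n * 2 ^ x k ≤ nonrandomCount U (x k) * 2 ^ Nat.log 2 (x k) := by
  obtain ⟨k, hk⟩ := hU.exists_div_le_nonrandomCount hx
  have h_dvd : 2 ^ (2 * k + 2) ∣ 2 ^ x k := by
    refine pow_dvd_pow 2 (le_trans ?_ (Nat.log_le_self 2 (x k)))
    exact (Nat.pow_le_pow_iff_right one_lt_two).1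
      ((Nat.le_mul_of_pos_left _ (Nat.pos_of_ne_zero hn)).trans (h k))
  refine ⟨k, ?_⟩
  calc n * 2 ^ x k = 2 ^ x k / 2 ^ (2 * k + 2) * (n * 2 ^ (2 * k + 2)) := by
        rw [mul_left_comm, Nat.div_mul_cancel h_dvd]
    _ ≤ nonrandomCount U (x k) * 2 ^ Nat.log 2 (x k) := Nat.mul_le_mul (hk k le_rfl) (h k)

/-! ### Dense lengths and the common lower bound -/

theorem primrec_sum {ι α : Type*} [Primcodable α] {f : ι → α → ℕ} (s : Finset ι)
    (hf : ∀ i ∈ s, Primrec (f i)) : Primrec fun a => ∑ i ∈ s, f i a := by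
  induction s using Finset.cons_induction with
  | empty => exact .const 0
  | cons i s hi ih =>
    rw [Finset.forall_mem_cons] at hf
    simpa only [Finset.sum_cons] using Primrec.nat_add.comp hf.1 (ih hf.2)

theorem frequently_notMem_of_tsum_lt_one {S : Set ℕ}
    (hS : ∑' x : S, (2⁻¹ : ℝ≥0∞) ^ Nat.log 2 x < 1) : ∃ᶠ x in atTop, x ∉ S := by
  intro h_eventually
  obtain ⟨N, hN⟩ := eventually_atTop.1 h_eventually
  let block := Finset.Ico (2 ^ N) (2 ^ (N + 1))
  have h_block (x : ℕ) (hx : x ∈ block) :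
      S.indicator (fun x => (2⁻¹ : ℝ≥0∞) ^ Nat.log 2 x) x = 2⁻¹ ^ N := by
    obtain ⟨h_lower, h_upper⟩ := Finset.mem_Ico.1 hx
    rw [Set.indicator_of_mem (not_not.1 (hN x (Nat.lt_two_pow_self.le.trans h_lower))),
      Nat.log_eq_of_pow_le_of_lt_pow h_lower h_upper]
  refine hS.not_ge ?_
  calc (1 : ℝ≥0∞) = ∑ x ∈ block, S.indicator (fun x => (2⁻¹ : ℝ≥0∞) ^ Nat.log 2 x) x := by
        rw [Finset.sum_congr rfl h_block, Finset.sum_const, Nat.card_Ico, pow_succ, mul_two,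
          Nat.add_sub_cancel, nsmul_eq_mul, Nat.cast_pow, Nat.cast_two, ← mul_pow,
          ENNReal.mul_inv_cancel two_ne_zero ENNReal.ofNat_ne_top, one_pow]
    _ ≤ ∑' x, S.indicator (fun x => (2⁻¹ : ℝ≥0∞) ^ Nat.log 2 x) x := ENNReal.sum_le_tsum _
    _ = _ := (tsum_subtype S _).symm

theorem exists_frequently_mul_le_and_eventually_lt {α : Type*} {l : Filter α} [l.NeBot]
    {f d : α → ℕ} {b : ℕ} (h : ∀ᶠ x in l, f x < b * d x) :
    ∃ q, (∃ᶠ x in l, q * d x ≤ f x) ∧ ∀ᶠ x in l, f x < (q + 1) * d x := by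
  classical
  have h_exists : ∃ b, ∀ᶠ x in l, f x < b * d x := ⟨b, h⟩
  obtain ⟨q, hq⟩ : ∃ q, Nat.find h_exists = q + 1 := Nat.exists_eq_succ_of_ne_zero fun h_zero => by
    obtain ⟨x, hx⟩ := (h_zero ▸ Nat.find_spec h_exists).exists
    simp at hx
  refine ⟨q, ?_, hq ▸ Nat.find_spec h_exists⟩
  simpa only [not_eventually, not_lt] using Nat.find_min h_exists (hq ▸ Nat.lt_succ_self q)

theorem eventually_add_log_le (k : ℕ) : ∀ᶠ x in atTop, k + Nat.log 2 x ≤ x := by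
  filter_upwards [eventually_ge_atTop (2 * k + 1)] with x hx
  have h_pow : 2 ^ Nat.log 2 x ≤ x := Nat.pow_log_le_self 2 (by omega)
  rcases h_log : Nat.log 2 x with _ | j
  · omega
  · rw [h_log, pow_succ] at h_pow
    have := j.lt_two_pow_self
    omega

theorem rePred_exists {α : Type*} [Primcodable α] {R : α → ℕ → Prop} (hR : PrimrecRel R) :
    REPred fun a => ∃ n, R a n := by
  classical
  have h_decide : Computable₂ fun a n => decide (R a n) := hR.decide.to_comp
  refine (Partrec.rfind h_decide.partrec₂).dom_re.of_eq fun a => ?_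
  refine (Nat.rfind_dom' (p := fun n => Part.some (decide (R a n)))).trans ?_
  simp

theorem computablePred_and {α : Type*} [Primcodable α] {p q : α → Prop} (hp : ComputablePred p)
    (hq : ComputablePred q) : ComputablePred fun a => p a ∧ q a := by
  obtain ⟨f, hf, rfl⟩ := ComputablePred.computable_iff.1 hp
  obtain ⟨f', hf', rfl⟩ := ComputablePred.computable_iff.1 hq
  exact ComputablePred.computable_iff.2
    ⟨fun a => f a && f' a, Primrec.and.to_comp.comp hf hf', by simp⟩

theorem ttReducible_of_nonrandomCount {U : List Bool →. List Bool} {A : Set ℕ} {C : ℕ → Prop}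
    {x m : ℕ → ℕ} (hC : PrimrecPred C) (hx : Primrec x) (hm : Primrec m)
    (hA : ∀ z, z ∈ A ↔ C z ∧ m z ≤ nonrandomCount U (x z)) :
    TTReducible A (randomStrings U) := by
  classical
  have h_count : Primrec fun r : List Bool => r.countP fun b => !b :=
    (primrec_countP (p := fun b (_ : Unit) => !b) (Primrec.not.comp .fst)).comp .id (.const ())
  have h_rel : PrimrecRel fun (r : List Bool) (k : ℕ) => k ≤ r.countP fun b => !b :=
    Primrec.nat_le.comp .snd (h_count.comp .fst)
  let rows (z : ℕ) : List (List Bool) :=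
    if C z then (stringsOfLength (2 ^ x z)).filter fun r => m z ≤ r.countP fun b => !b else []
  have h_rows : Primrec rows := Primrec.ite hC (h_rel.listFilter.comp
    (primrec_stringsOfLength.comp (primrec_two_pow.comp hx)) hm) (.const [])
  refine ⟨fun z => stringsOfLength (x z), rows, (primrec_stringsOfLength.comp hx).to_comp,
    h_rows.to_comp, fun z => ?_⟩
  simp only [hA, rows, List.mem_ite_nil_right, List.mem_filter, mem_stringsOfLength,
    List.length_map, length_stringsOfLength, true_and, decide_eq_true_eq, List.countP_map,
    nonrandomCount, Function.comp_def, decide_not]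

section

variable {ι : Type*} [Fintype ι]

/-- The number of strings of length `x` that the enumerations `g i` have produced by stage `t`,
a string being counted once for each enumeration that has produced it. -/
def totalCount (g : ι → List Bool → ℕ → Bool) (x t : ℕ) : ℕ := ∑ i, stageCount (g i) x t

/-- The number of nonrandom strings of length `x`, a string being counted once for each machine
`U i` with respect to which it is not random; this is the limit of `totalCount`. -/
noncomputable def totalNonrandom (U : ι → List Bool →. List Bool) (x : ℕ) : ℕ :=
  ∑ i, nonrandomCount (U i) x

/-- At stage `t` the enumerations `g i` have produced on average at least a `2⁻¹ ^ Nat.log 2 x`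
fraction of the strings of length `x`. The threshold is chosen because `∑ 2⁻¹ ^ Nat.log 2 x` over
all `x` diverges, whereas over the dense lengths it is bounded. -/
def DenseAt (g : ι → List Bool → ℕ → Bool) (x t : ℕ) : Prop :=
  Fintype.card ι * 2 ^ x ≤ totalCount g x t * 2 ^ Nat.log 2 x

/-- The codes `z` of pairs `(x, t)` such that the length `x ≥ m` is not dense at stage `t` but has
by then reached level `q`, that is, `q` times the gap. -/
def Candidate (g : ι → List Bool → ℕ → Bool) (a q m z : ℕ) : Prop :=
  m ≤ z.unpair.1 ∧ ¬ DenseAt g z.unpair.1 z.unpair.2 ∧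
    q * gap a z.unpair.1 ≤ totalCount g z.unpair.1 z.unpair.2

/-- The candidates `(x, t)` whose length `x` eventually becomes dense. For suitable parameters this
is the set reducible to the random strings of all the machines. -/
def commonSet (g : ι → List Bool → ℕ → Bool) (a q m : ℕ) : Set ℕ :=
  {z | Candidate g a q m z ∧ ∃ t, DenseAt g z.unpair.1 t}

section

variable {g : ι → List Bool → ℕ → Bool} (hg : ∀ i, Primrec₂ (g i))
include hg

theorem primrec_totalCount : Primrec₂ (totalCount g) :=
  primrec_sum Finset.univ fun i _ => primrec_stageCount (hg i)

theorem primrecRel_denseAt : PrimrecRel (DenseAt g) :=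
  Primrec.nat_le.comp
    (Primrec.nat_mul.comp (.const (Fintype.card ι)) (primrec_two_pow.comp .fst))
    (Primrec.nat_mul.comp (primrec_totalCount hg)
      (primrec_two_pow.comp (primrec_log_two.comp .fst)))

theorem primrecPred_candidate (a q m : ℕ) : PrimrecPred (Candidate g a q m) := by
  have h_length : Primrec fun z : ℕ => z.unpair.1 := Primrec.fst.comp .unpair
  have h_stage : Primrec fun z : ℕ => z.unpair.2 := Primrec.snd.comp .unpair
  exact (Primrec.nat_le.comp (.const m) h_length).and <|
    ((primrecRel_denseAt hg).comp h_length h_stage).not.and <|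
      Primrec.nat_le.comp
        (Primrec.nat_mul.comp (.const q) (primrec_gap.comp (.const a) h_length))
        ((primrec_totalCount hg).comp h_length h_stage)

theorem rePred_commonSet (a q m : ℕ) : REPred fun z => z ∈ commonSet g a q m := by
  have h_rel : PrimrecRel fun z t : ℕ => Candidate g a q m z ∧ DenseAt g z.unpair.1 t :=
    ((primrecPred_candidate hg a q m).comp .fst).and <|
      (primrecRel_denseAt hg).comp (Primrec.fst.comp (Primrec.unpair.comp .fst)) .snd
  exact (rePred_exists h_rel).of_eq fun z => exists_and_left

end

section

variable {g : ι → List Bool → ℕ → Bool} {U : ι → List Bool →. List Bool}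
  (hg : ∀ i, EnumeratesNonrandom (g i) (U i))
include hg

theorem monotone_totalCount (x : ℕ) : Monotone (totalCount g x) := fun _ _ hst =>
  Finset.sum_le_sum fun i _ => (hg i).monotone_stageCount x hst

theorem eventually_totalCount_eq (x : ℕ) :
    ∀ᶠ t in atTop, totalCount g x t = totalNonrandom U x := by
  filter_upwards [eventually_all.2 fun i => (hg i).eventually_stageCount_eq x] with t ht
  exact Finset.sum_congr rfl fun i _ => ht i

theorem totalCount_add_le {i : ι} {x t k : ℕ}
    (h : stageCount (g i) x t + k ≤ nonrandomCount (U i) x) :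
    totalCount g x t + k ≤ totalNonrandom U x := by
  classical
  rw [totalCount, totalNonrandom, ← Finset.add_sum_erase _ _ (Finset.mem_univ i),
    ← Finset.add_sum_erase _ (fun i => nonrandomCount (U i) x) (Finset.mem_univ i), add_right_comm]
  exact add_le_add h (Finset.sum_le_sum fun j _ => (hg j).stageCount_le x t)

theorem monotone_denseAt (x : ℕ) : Monotone (DenseAt g x) := fun _ _ hst h =>
  h.trans (Nat.mul_le_mul_right _ (monotone_totalCount hg x hst))

theorem exists_denseAt_iff {x : ℕ} :
    (∃ t, DenseAt g x t) ↔
      Fintype.card ι * 2 ^ x ≤ totalNonrandom U x * 2 ^ Nat.log 2 x := by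
  obtain ⟨s, hs⟩ := eventually_atTop.1 (eventually_totalCount_eq hg x)
  refine ⟨fun ⟨t, ht⟩ => ?_, fun h => ⟨s, by rwa [DenseAt, hs s le_rfl]⟩⟩
  rw [← hs (max s t) (le_max_left s t)]
  exact monotone_denseAt hg x (le_max_right s t) ht

theorem tsum_denseAt_le [Nonempty ι] (hU : ∀ i, IsPrefixFreeMachine (U i)) :
    ∑' x : {x | ∃ t, DenseAt g x t}, (2⁻¹ : ℝ≥0∞) ^ Nat.log 2 x ≤ 2⁻¹ := by
  have h_card : (Fintype.card ι : ℝ≥0∞) ≠ 0 := by simp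
  refine (ENNReal.mul_le_mul_iff_right h_card (ENNReal.natCast_ne_top _)).1 ?_
  calc Fintype.card ι * ∑' x : {x | ∃ t, DenseAt g x t}, (2⁻¹ : ℝ≥0∞) ^ Nat.log 2 x
      ≤ ∑' x : {x | ∃ t, DenseAt g x t}, totalNonrandom U x * (2⁻¹ : ℝ≥0∞) ^ (x : ℕ) := by
        rw [← ENNReal.tsum_mul_left]
        exact ENNReal.tsum_le_tsum fun x =>
          natCast_mul_inv_two_pow_le_iff.2 ((exists_denseAt_iff hg).1 x.2)
    _ ≤ ∑' x, totalNonrandom U x * (2⁻¹ : ℝ≥0∞) ^ x :=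
        ENNReal.tsum_comp_le_tsum_of_injective Subtype.val_injective
          fun x => totalNonrandom U x * (2⁻¹ : ℝ≥0∞) ^ x
    _ = ∑ i, ∑' x, nonrandomCount (U i) x * (2⁻¹ : ℝ≥0∞) ^ x := by
        rw [← Summable.tsum_finsetSum fun i _ => ENNReal.summable]
        simp only [totalNonrandom, Nat.cast_sum, Finset.sum_mul]
    _ ≤ ∑ _i : ι, 2⁻¹ := Finset.sum_le_sum fun i _ => tsum_nonrandomCount_le (hU i)
    _ = Fintype.card ι * 2⁻¹ := by rw [Finset.sum_const, Finset.card_univ, nsmul_eq_mul]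

theorem exists_denseAt_of_computable [Nonempty ι] (hU : ∀ i, IsUniversal (U i)) {x : ℕ → ℕ}
    (hx : Computable x) (h : ∀ k, Fintype.card ι * 2 ^ (2 * k + 2) ≤ 2 ^ Nat.log 2 (x k)) :
    ∃ k t, DenseAt g (x k) t := by
  let i := Classical.arbitrary ι
  obtain ⟨k, hk⟩ := (hU i).exists_mul_two_pow_le_nonrandomCount hx Fintype.card_ne_zero h
  refine ⟨k, (exists_denseAt_iff hg).2 (hk.trans (Nat.mul_le_mul_right _ ?_))⟩
  exact Finset.single_le_sum (f := fun i => nonrandomCount (U i) (x k))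
    (fun _ _ => Nat.zero_le _) (Finset.mem_univ i)

theorem totalNonrandom_lt_mul_gap {a x : ℕ} (h_le : 2 * a + 2 + Nat.log 2 x ≤ x)
    (h : ∀ t, ¬ DenseAt g x t) :
    totalNonrandom U x < Fintype.card ι * 2 ^ (2 * a + 2) * gap a x := by
  have h_gap : gap a x * 2 ^ (2 * a + 2 + Nat.log 2 x) = 2 ^ x :=
    Nat.div_mul_cancel (pow_dvd_pow 2 h_le)
  refine Nat.lt_of_mul_lt_mul_right (a := 2 ^ Nat.log 2 x) ?_
  calc totalNonrandom U x * 2 ^ Nat.log 2 x < Fintype.card ι * 2 ^ x :=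
        not_le.1 (mt (exists_denseAt_iff hg).2 (not_exists.2 h))
    _ = Fintype.card ι * 2 ^ (2 * a + 2) * gap a x * 2 ^ Nat.log 2 x := by
        rw [← h_gap, pow_add]; ring

theorem exists_maximal_level [Nonempty ι] (hU : ∀ i, IsPrefixFreeMachine (U i)) (a : ℕ) :
    ∃ q m, (∃ᶠ x in atTop, (∀ t, ¬ DenseAt g x t) ∧ q * gap a x ≤ totalNonrandom U x) ∧
      ∀ x ≥ m, (∀ t, ¬ DenseAt g x t) → totalNonrandom U x < (q + 1) * gap a x := by
  let neverDense : Filter ℕ := atTop ⊓ 𝓟 {x | ∀ t, ¬ DenseAt g x t}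
  have h_neBot : neverDense.NeBot := frequently_mem_iff_neBot.1 <| by
    simpa using frequently_notMem_of_tsum_lt_one
      ((tsum_denseAt_le hg hU).trans_lt ENNReal.one_half_lt_one)
  have h_bounded : ∀ᶠ x in neverDense,
      totalNonrandom U x < Fintype.card ι * 2 ^ (2 * a + 2) * gap a x := by
    refine eventually_inf_principal.2 ?_
    filter_upwards [eventually_add_log_le (2 * a + 2)] with x hx h
    exact totalNonrandom_lt_mul_gap hg hx h
  obtain ⟨q, h_frequently, h_eventually⟩ := exists_frequently_mul_le_and_eventually_lt h_bounded
  obtain ⟨m, hm⟩ := eventually_atTop.1 (eventually_inf_principal.1 h_eventually)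
  exact ⟨q, m, frequently_inf_principal.1 h_frequently, hm⟩

theorem mem_commonSet_iff {a q m : ℕ} {i : ι}
    (h_growth : ∀ x t, ¬ DenseAt g x t → (∃ s, DenseAt g x s) →
      stageCount (g i) x t + gap a x ≤ nonrandomCount (U i) x)
    (h_level : ∀ x ≥ m, (∀ t, ¬ DenseAt g x t) → totalNonrandom U x < (q + 1) * gap a x)
    {z : ℕ} : z ∈ commonSet g a q m ↔ Candidate g a q m z ∧
      stageCount (g i) z.unpair.1 z.unpair.2 + gap a z.unpair.1
        ≤ nonrandomCount (U i) z.unpair.1 := by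
  refine and_congr_right fun ⟨h_length, h_not_dense, h_reached⟩ =>
    ⟨h_growth _ _ h_not_dense, fun h => ?_⟩
  by_contra! h_never
  refine (h_level _ h_length h_never).not_ge ?_
  calc (q + 1) * gap a z.unpair.1 ≤ totalCount g z.unpair.1 z.unpair.2 + gap a z.unpair.1 := by
        rw [add_mul, one_mul]; gcongr
    _ ≤ totalNonrandom U z.unpair.1 := totalCount_add_le hg h

theorem ttReducible_commonSet {a q m : ℕ} {i : ι}
    (h_growth : ∀ x t, ¬ DenseAt g x t → (∃ s, DenseAt g x s) →
      stageCount (g i) x t + gap a x ≤ nonrandomCount (U i) x)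
    (h_level : ∀ x ≥ m, (∀ t, ¬ DenseAt g x t) → totalNonrandom U x < (q + 1) * gap a x) :
    TTReducible (commonSet g a q m) (randomStrings (U i)) := by
  have h_length : Primrec fun z : ℕ => z.unpair.1 := Primrec.fst.comp .unpair
  have h_stage : Primrec fun z : ℕ => z.unpair.2 := Primrec.snd.comp .unpair
  exact ttReducible_of_nonrandomCount (primrecPred_candidate (fun i => (hg i).primrec) a q m)
    h_length (Primrec.nat_add.comp ((primrec_stageCount (hg i).primrec).comp h_length h_stage)
      (primrec_gap.comp (.const a) h_length)) fun _ => mem_commonSet_iff hg h_growth h_level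

theorem exists_notMem_commonSet_candidate {a q m : ℕ}
    (h_level : ∃ᶠ x in atTop, (∀ t, ¬ DenseAt g x t) ∧ q * gap a x ≤ totalNonrandom U x) (n : ℕ) :
    ∃ z, z ∉ commonSet g a q m ∧ Candidate g a q m z ∧ n ≤ 2 ^ Nat.log 2 z.unpair.1 := by
  obtain ⟨x, ⟨h_never, h_reached⟩, hx_ge, hx_pow⟩ := (h_level.and_eventually
    ((eventually_ge_atTop m).and (eventually_ge_atTop (2 ^ n)))).exists
  obtain ⟨t, ht⟩ := (eventually_totalCount_eq hg x).exists
  refine ⟨Nat.pair x t, ?_, ?_, ?_⟩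
  · rintro ⟨-, s, hs⟩
    rw [Nat.unpair_pair] at hs
    exact h_never s hs
  · rw [Candidate, Nat.unpair_pair, ht]
    exact ⟨hx_ge, h_never t, h_reached⟩
  · rw [Nat.unpair_pair]
    exact Nat.lt_two_pow_self.le.trans
      (Nat.pow_le_pow_right two_pos (Nat.le_log_of_pow_le one_lt_two hx_pow))

theorem not_computablePred_commonSet [Nonempty ι] (hU : ∀ i, IsUniversal (U i)) {a q m : ℕ}
    (h_level : ∃ᶠ x in atTop, (∀ t, ¬ DenseAt g x t) ∧ q * gap a x ≤ totalNonrandom U x) :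
    ¬ ComputablePred fun z => z ∈ commonSet g a q m := by
  classical
  intro h_computable
  have h_primrec (i : ι) : Primrec₂ (g i) := (hg i).primrec
  let Good (k z : ℕ) : Prop := z ∉ commonSet g a q m ∧ Candidate g a q m z ∧
    Fintype.card ι * 2 ^ (2 * k + 2) ≤ 2 ^ Nat.log 2 z.unpair.1
  have h_length : Primrec fun z : ℕ => z.unpair.1 := Primrec.fst.comp .unpair
  have h_search : ComputablePred fun p : ℕ × ℕ => Good p.1 p.2 := by
    have h_bound : PrimrecPred fun p : ℕ × ℕ =>
        Fintype.card ι * 2 ^ (2 * p.1 + 2) ≤ 2 ^ Nat.log 2 p.2.unpair.1 :=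
      Primrec.nat_le.comp (Primrec.nat_mul.comp (.const _) (primrec_two_pow.comp
          (Primrec.nat_add.comp (Primrec.nat_mul.comp (.const 2) .fst) (.const 2))))
        (primrec_two_pow.comp (primrec_log_two.comp (h_length.comp .snd)))
    have h_notMem : ComputablePred fun p : ℕ × ℕ => p.2 ∉ commonSet g a q m :=
      ComputablePred.computable_of_manyOneReducible ⟨Prod.snd, .snd, fun _ => Iff.rfl⟩
        h_computable.not
    exact computablePred_and h_notMem
      (((primrecPred_candidate h_primrec a q m).comp .snd).and h_bound).computablePred
  have h_exists (k : ℕ) : ∃ z, Good k z :=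
    exists_notMem_commonSet_candidate hg h_level _
  have h_find : Computable fun k => Nat.find (h_exists k) := Computable.find h_search h_exists
  obtain ⟨k, t, h_dense⟩ := exists_denseAt_of_computable hg hU (h_length.to_comp.comp h_find)
    fun k => (Nat.find_spec (h_exists k)).2.2
  have h_good := Nat.find_spec (h_exists k)
  exact h_good.1 ⟨h_good.2.1, t, h_dense⟩

end

end

theorem mainTheorem2_general {ι : Type*} [Finite ι] [Nonempty ι] {U : ι → List Bool →. List Bool}
    (hU : ∀ i, IsUniversal (U i)) :
    ∃ A : Set ℕ, REPred (fun n => n ∈ A) ∧ ¬ ComputablePred (fun n => n ∈ A) ∧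
      ∀ i, TTReducible A (randomStrings (U i)) := by
  cases nonempty_fintype ι
  choose g hg using fun i => exists_enumeratesNonrandom (hU i).machine.partrec
  have h_primrec (i : ι) : Primrec₂ (g i) := (hg i).primrec
  have h_machine (i : ι) : IsPrefixFreeMachine (U i) := (hU i).machine
  choose c h_growth using fun i => (hU i).exists_stageCount_add_gap_le (hg i)
    (primrecRel_denseAt h_primrec) (monotone_denseAt hg)
    ((tsum_denseAt_le hg h_machine).trans ENNReal.one_half_lt_one.le)
  let a := ∑ i, c i
  have h_le (i : ι) : c i ≤ a := Finset.single_le_sum_of_canonicallyOrdered (Finset.mem_univ i)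
  obtain ⟨q, m, h_frequently, h_level⟩ := exists_maximal_level hg h_machine a
  exact ⟨commonSet g a q m, rePred_commonSet h_primrec a q m,
    not_computablePred_commonSet hg hU h_frequently,
    fun i => ttReducible_commonSet hg (h_growth i a (h_le i)) h_level⟩

end RandomStrings

theorem mainTheorem2 (U₁ U₂ : List Bool →. List Bool)
    (hU₁ : RandomStrings.IsUniversal U₁) (hU₂ : RandomStrings.IsUniversal U₂) :
    (∃ A : Set ℕ, REPred (fun n => n ∈ A) ∧ ¬ ComputablePred (fun n => n ∈ A) ∧
      RandomStrings.TTReducible A (RandomStrings.randomStrings U₁) ∧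
      RandomStrings.TTReducible A (RandomStrings.randomStrings U₂)) ∧
    ¬ RandomStrings.TTMinimalPair (RandomStrings.randomStrings U₁)
      (RandomStrings.randomStrings U₂) := by
  obtain ⟨A, h_re, h_not_computable, h_tt⟩ := RandomStrings.mainTheorem2_general
    (U := ![U₁, U₂]) (Fin.forall_fin_two.2 ⟨hU₁, hU₂⟩)
  obtain ⟨h_tt₁, h_tt₂⟩ := Fin.forall_fin_two.1 h_tt
  exact ⟨⟨A, h_re, h_not_computable, h_tt₁, h_tt₂⟩,
    fun h_pair => h_not_computable (h_pair.2.2 A h_tt₁ h_tt₂)⟩
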